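/- For $\nu \in \mathbb{C}$ and $x > 0$ let $K_\nu(x)$ be the modified Bessel function of the second kind, $$K_\nu(x) = \frac{x^\nu}{2^{\nu+1}} \int_0^\infty \exp\left(-t - \frac{x^2}{4t}\right) \frac{dt}{t^{\nu+1}}.$$ Let $a > 0$ be real and let $\nu, \lambda, \rho \in \mathbb{C}$ satisfy $|\operatorname{Re}\nu| + |\operatorname{Re}\lambda| < \operatorname{Re}\rho$, $\nu \notin \mathbb{Z}$ and $\rho \notin \{1, 2, 3, \dots\}$. Then $x \mapsto x^{\rho-1} K_\nu(ax) K_\lambda(ax)$ is (absolutely) integrable on $(0,\infty)$, and $$\int_0^\infty x^{\rho-1} K_\nu(ax) K_\lambda(ax)\, dx = \frac{2^{\rho-3}\, \Gamma(\nu)\, \Gamma\left(\frac{\rho+\lambda-\nu}{2}\right) \Gamma\left(\frac{\rho-\lambda-\nu}{2}\right) \Gamma(1-\nu)\, \Gamma(1-\rho)}{a^\rho\, \Gamma\left(1-\frac{\rho+\nu+\lambda}{2}\right) \Gamma\left(1-\frac{\rho+\nu-\lambda}{2}\right)} + \frac{2^{\rho-3}\, \Gamma(-\nu)\, \Gamma\left(\frac{\rho+\lambda+\nu}{2}\right)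 \Gamma\left(\frac{\nu+\rho-\lambda}{2}\right) \Gamma(\nu+1)\, \Gamma(1-\rho)}{a^\rho\, \Gamma\left(1-\frac{\rho-\nu-\lambda}{2}\right) \Gamma\left(1-\frac{\rho-\nu+\lambda}{2}\right)},$$ where $1/\Gamma$ is read as $0$ at the poles of $\Gamma$. -/

import Mathlib

open MeasureTheory

/-- The modified Bessel function of the second kind (Macdonald function) `K_ν(x)` of complex
order `ν` and real argument `x > 0`, by its integral representation
`K_ν(x) = x ^ ν / 2 ^ (ν + 1) * ∫_0^∞ exp (-t - x² / (4 t)) dt / t ^ (ν + 1)`,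
which converges absolutely for every `ν : ℂ` and every `x > 0`.
The values at `x ≤ 0` are not used. -/
noncomputable def besselK (ν : ℂ) (x : ℝ) : ℂ :=
  (x : ℂ) ^ ν / (2 : ℂ) ^ (ν + 1) *
    ∫ t in Set.Ioi (0 : ℝ),
      ((Real.exp (-t - x ^ 2 / (4 * t)) : ℝ) : ℂ) / (t : ℂ) ^ (ν + 1)

/-! Rescaling reduces to a = 1. In the integral for K_λ put u = t·w, with t the variable of the
integral for K_ν: the two exponents combine to -(1+w)t - x²(1+w)/(4tw), so the Mellin integral
becomes a triple integral of `tripleKernel` over x, t, w > 0. It converges absolutely, and Fubini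
evaluates it as a Gaussian moment in x, a Gamma integral in t and a beta integral in w. The result
is 2^(ρ-3)/Γ(ρ) times the product of the four Γ((ρ±ν±λ)/2)
(`integral_cpow_mul_besselK_mul_besselK`). The two-term right-hand side is this same quantity: the
reflection formula turns every Γ(1-z) into sines, and the claim becomes a trigonometric identity
(`gamma_reflection_sum`). -/

/-! ### Gamma integrals with complex exponent. -/

open Complex in
lemma integrableOn_cpow_mul_exp_neg_mul_Ioi {s : ℂ} (hs : 0 < s.re) {r : ℝ} (hr : 0 < r) :
    IntegrableOn (fun t : ℝ => (t : ℂ) ^ (s - 1) * ((Real.exp (-(r * t)) : ℝ) : ℂ))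
      (Set.Ioi (0 : ℝ)) := by
  have h : IntegrableOn (fun t : ℝ => t ^ (s.re - 1) * Real.exp (-r * t ^ (1 : ℝ)))
      (Set.Ioi (0 : ℝ)) :=
    integrableOn_rpow_mul_exp_neg_mul_rpow (by linarith) one_pos hr
  refine Integrable.mono' h (by fun_prop) ?_
  refine (ae_restrict_mem measurableSet_Ioi).mono fun t ht => ?_
  rw [norm_mul, norm_cpow_eq_rpow_re_of_pos ht, norm_real, Real.norm_of_nonneg (Real.exp_pos _).le,
    Real.rpow_one]
  simp

open Complex in
lemma integral_cpow_mul_exp_neg_real_mul_Ioi {s : ℂ} (hs : 0 < s.re) {r : ℝ} (hr : 0 < r) :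
    ∫ t in Set.Ioi (0 : ℝ), (t : ℂ) ^ (s - 1) * ((Real.exp (-(r * t)) : ℝ) : ℂ) =
      (r : ℂ) ^ (-s) * Gamma s := by
  have h := integral_cpow_mul_exp_neg_mul_Ioi (a := s) (r := r) hs (by simpa using hr)
  rw [one_div, inv_cpow _ _ (by rw [arg_ofReal_of_nonneg hr.le]; exact Real.pi_pos.ne),
    ← cpow_neg] at h
  rw [← h]
  push_cast
  rfl

open Complex in
lemma integral_norm_cpow_mul_exp_neg_mul_Ioi {s : ℂ} (hs : 0 < s.re) {r : ℝ} (hr : 0 < r) :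
    ∫ t in Set.Ioi (0 : ℝ), ‖(t : ℂ) ^ (s - 1) * ((Real.exp (-(r * t)) : ℝ) : ℂ)‖ =
      ‖(r : ℂ) ^ (-s)‖ * Real.Gamma s.re := by
  have h := Real.integral_rpow_mul_exp_neg_mul_Ioi hs hr
  rw [norm_cpow_eq_rpow_re_of_pos hr, neg_re, Real.rpow_neg hr.le, ← Real.inv_rpow hr.le,
    ← one_div, ← h]
  refine setIntegral_congr_fun measurableSet_Ioi fun t ht => ?_
  rw [norm_mul, norm_cpow_eq_rpow_re_of_pos ht, norm_real, Real.norm_of_nonneg (Real.exp_pos _).le]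
  simp

/-! ### Gaussian moments, by the substitution y = x². -/

lemma integrableOn_Ioi_comp_sq {E : Type*} [NormedAddCommGroup E] [NormedSpace ℝ E] {g : ℝ → E}
    (hg : IntegrableOn g (Set.Ioi 0)) :
    IntegrableOn (fun x : ℝ => x • g (x ^ 2)) (Set.Ioi 0) := by
  have := (integrableOn_Ioi_comp_rpow_iff' g (p := 2) two_ne_zero).2 hg
  refine this.congr_fun (fun x _ => ?_) measurableSet_Ioi
  norm_num

lemma integral_Ioi_comp_sq {E : Type*} [NormedAddCommGroup E] [NormedSpace ℝ E] (g : ℝ → E) :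
    ∫ x in Set.Ioi (0 : ℝ), x • g (x ^ 2) = (1 / 2 : ℝ) • ∫ x in Set.Ioi (0 : ℝ), g x := by
  rw [← integral_comp_rpow_Ioi_of_pos (g := g) (p := 2) two_pos, ← integral_smul]
  refine setIntegral_congr_fun measurableSet_Ioi fun x _ => ?_
  rw [smul_smul]
  congr 1
  · norm_num [← mul_assoc]
  · norm_num

open Complex in
lemma smul_sq_cpow_mul_exp (c : ℂ) (r : ℝ) {x : ℝ} (hx : 0 < x) :
    x • (((x ^ 2 : ℝ) : ℂ) ^ (c / 2 - 1) * ((Real.exp (-(r * x ^ 2)) : ℝ) : ℂ)) =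
      (x : ℂ) ^ (c - 1) * ((Real.exp (-(r * x ^ 2)) : ℝ) : ℂ) := by
  have hx' : (x : ℂ) ≠ 0 := by exact_mod_cast hx.ne'
  rw [real_smul, ← mul_assoc]
  congr 1
  have : ((x ^ 2 : ℝ) : ℂ) = (x : ℂ) * x := by push_cast; ring
  rw [this, mul_cpow_ofReal_nonneg hx.le hx.le, ← cpow_add _ _ hx',
    show c - 1 = 1 + (c / 2 - 1 + (c / 2 - 1)) by ring, cpow_add 1 _ hx', cpow_one]

lemma integrableOn_cpow_mul_exp_neg_mul_sq_Ioi {c : ℂ} (hc : 0 < c.re) {r : ℝ} (hr : 0 < r) :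
    IntegrableOn (fun x : ℝ => (x : ℂ) ^ (c - 1) * ((Real.exp (-(r * x ^ 2)) : ℝ) : ℂ))
      (Set.Ioi (0 : ℝ)) :=
  (integrableOn_Ioi_comp_sq (integrableOn_cpow_mul_exp_neg_mul_Ioi (s := c / 2)
    (by simpa using hc) hr)).congr_fun (fun _ hx => smul_sq_cpow_mul_exp c r hx) measurableSet_Ioi

lemma integral_cpow_mul_exp_neg_mul_sq_Ioi {c : ℂ} (hc : 0 < c.re) {r : ℝ} (hr : 0 < r) :
    ∫ x in Set.Ioi (0 : ℝ), (x : ℂ) ^ (c - 1) * ((Real.exp (-(r * x ^ 2)) : ℝ) : ℂ) =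
      (r : ℂ) ^ (-(c / 2)) * (Complex.Gamma (c / 2) / 2) := by
  rw [← setIntegral_congr_fun measurableSet_Ioi fun x hx => smul_sq_cpow_mul_exp c r hx,
    integral_Ioi_comp_sq (fun y : ℝ => (y : ℂ) ^ (c / 2 - 1) * ((Real.exp (-(r * y)) : ℝ) : ℂ)),
    integral_cpow_mul_exp_neg_real_mul_Ioi (by simpa using hc) hr, Complex.real_smul]
  push_cast
  ring

lemma integral_norm_cpow_mul_exp_neg_mul_sq_Ioi {c : ℂ} (hc : 0 < c.re) {r : ℝ} (hr : 0 < r) :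
    ∫ x in Set.Ioi (0 : ℝ), ‖(x : ℂ) ^ (c - 1) * ((Real.exp (-(r * x ^ 2)) : ℝ) : ℂ)‖ =
      ‖(r : ℂ) ^ (-(c / 2))‖ * (Real.Gamma (c / 2).re / 2) := by
  have h := integral_Ioi_comp_sq
    (fun y : ℝ => ‖(y : ℂ) ^ (c / 2 - 1) * ((Real.exp (-(r * y)) : ℝ) : ℂ)‖)
  rw [integral_norm_cpow_mul_exp_neg_mul_Ioi (by simpa using hc) hr] at h
  rw [← setIntegral_congr_fun measurableSet_Ioi
    fun x hx => congrArg norm (smul_sq_cpow_mul_exp c r hx)]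
  rw [show ∀ u v : ℝ, u * (v / 2) = (1 / 2 : ℝ) • (u * v) by intro u v; simp; ring, ← h]
  refine setIntegral_congr_fun measurableSet_Ioi fun x hx => ?_
  simp only [norm_smul, Real.norm_of_nonneg (le_of_lt (Set.mem_Ioi.1 hx)), smul_eq_mul]

/-! ### The beta integral on the half-line. -/

open Complex in
lemma integrable_beta_kernel {p q : ℂ} (hp : 0 < p.re) (hq : 0 < q.re) :
    Integrable (fun z : ℝ × ℝ => (z.1 : ℂ) ^ (p + q - 1) * ((Real.exp (-z.1) : ℝ) : ℂ) *
        ((z.2 : ℂ) ^ (q - 1) * ((Real.exp (-(z.1 * z.2)) : ℝ) : ℂ)))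
      ((volume.restrict (Set.Ioi (0 : ℝ))).prod (volume.restrict (Set.Ioi (0 : ℝ)))) := by
  rw [integrable_prod_iff (Measurable.aestronglyMeasurable (by fun_prop))]
  refine ⟨(ae_restrict_mem measurableSet_Ioi).mono fun t ht =>
    (integrableOn_cpow_mul_exp_neg_mul_Ioi hq ht).const_mul
      ((t : ℂ) ^ (p + q - 1) * ((Real.exp (-t) : ℝ) : ℂ)), ?_⟩
  refine ((integrableOn_cpow_mul_exp_neg_mul_Ioi hp one_pos).norm.mul_const
    (Real.Gamma q.re)).congr ?_
  refine (ae_restrict_mem measurableSet_Ioi).mono fun t ht => ?_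
  have ht' : (t : ℂ) ≠ 0 := by exact_mod_cast (ne_of_gt ht)
  simp only [norm_mul (_ * _ : ℂ) (_ * _)]
  rw [integral_const_mul, integral_norm_cpow_mul_exp_neg_mul_Ioi hq ht, ← mul_assoc, ← norm_mul,
    one_mul, mul_right_comm, ← cpow_add _ _ ht']
  ring_nf

-- Fubini for the kernel t^(p+q-1) e^(-t) w^(q-1) e^(-tw): integrating t first leaves Γ(p+q) times
-- the beta integrand, integrating w first leaves Γ(q) t^(p-1) e^(-t).
open Complex in
lemma integrableOn_cpow_mul_one_add_cpow {p q : ℂ} (hp : 0 < p.re) (hq : 0 < q.re) :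
    IntegrableOn (fun w : ℝ => (w : ℂ) ^ (q - 1) * ((1 + w : ℝ) : ℂ) ^ (-(p + q)))
        (Set.Ioi (0 : ℝ)) ∧
      (∫ w in Set.Ioi (0 : ℝ), (w : ℂ) ^ (q - 1) * ((1 + w : ℝ) : ℂ) ^ (-(p + q))) *
        Gamma (p + q) = Gamma p * Gamma q := by
  have hpq : 0 < (p + q).re := by rw [add_re]; positivity
  have hΓ : Gamma (p + q) ≠ 0 := Gamma_ne_zero_of_re_pos hpq
  have hint := integrable_beta_kernel hp hq
  have hleft : ∀ w ∈ Set.Ioi (0 : ℝ),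
      (∫ t in Set.Ioi (0 : ℝ), (t : ℂ) ^ (p + q - 1) * ((Real.exp (-t) : ℝ) : ℂ) *
        ((w : ℂ) ^ (q - 1) * ((Real.exp (-(t * w)) : ℝ) : ℂ))) =
      (w : ℂ) ^ (q - 1) * ((1 + w : ℝ) : ℂ) ^ (-(p + q)) * Gamma (p + q) := by
    intro w hw
    have hw' : 0 < 1 + w := by have := Set.mem_Ioi.1 hw; linarith
    rw [mul_assoc, ← integral_cpow_mul_exp_neg_real_mul_Ioi hpq hw', ← integral_const_mul]
    congr 1 with t
    rw [show -((1 + w) * t) = -t + -(t * w) by ring, Real.exp_add]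
    push_cast
    ring
  constructor
  · refine (hint.integral_prod_right.mul_const (Gamma (p + q))⁻¹).congr ?_
    refine (ae_restrict_mem measurableSet_Ioi).mono fun w hw => ?_
    simp only [hleft w hw]
    rw [mul_assoc, mul_inv_cancel₀ hΓ, mul_one]
  · rw [← integral_mul_const, ← setIntegral_congr_fun measurableSet_Ioi hleft,
      ← integral_prod_symm _ hint, integral_prod _ hint]
    have h1 := integral_cpow_mul_exp_neg_real_mul_Ioi hp one_pos
    rw [ofReal_one, one_cpow, one_mul] at h1
    rw [← h1,
      ← integral_mul_const]
    refine setIntegral_congr_fun measurableSet_Ioi fun t ht => ?_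
    have ht' : (t : ℂ) ≠ 0 := by exact_mod_cast (ne_of_gt ht)
    simp only
    rw [integral_const_mul, integral_cpow_mul_exp_neg_real_mul_Ioi hq ht, ← mul_assoc,
      one_mul, mul_right_comm _ _ ((t : ℂ) ^ (-q)), ← cpow_add _ _ ht']
    ring_nf

/-! ### The double and triple integrals. -/

-- The t-integral contributes Γ(d)(1+w)^(-d), leaving a beta integrand with parameters s+d-q and q.
open Complex in
lemma integrable_double_kernel {s d q : ℂ} (hd : 0 < d.re) (hq : 0 < q.re)
    (hp : 0 < (s + d - q).re) :
    Integrable (fun z : ℝ × ℝ => (z.2 : ℂ) ^ (q - 1) * ((1 + z.2 : ℝ) : ℂ) ^ (-s) *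
        ((z.1 : ℂ) ^ (d - 1) * ((Real.exp (-((1 + z.2) * z.1)) : ℝ) : ℂ)))
      ((volume.restrict (Set.Ioi (0 : ℝ))).prod (volume.restrict (Set.Ioi (0 : ℝ)))) := by
  rw [integrable_prod_iff' (Measurable.aestronglyMeasurable (by fun_prop))]
  refine ⟨(ae_restrict_mem measurableSet_Ioi).mono fun w hw =>
    (integrableOn_cpow_mul_exp_neg_mul_Ioi hd (r := 1 + w)
      (by have := Set.mem_Ioi.1 hw; linarith)).const_mul
        ((w : ℂ) ^ (q - 1) * ((1 + w : ℝ) : ℂ) ^ (-s)), ?_⟩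
  refine ((integrableOn_cpow_mul_one_add_cpow hp hq).1.norm.mul_const (Real.Gamma d.re)).congr ?_
  refine (ae_restrict_mem measurableSet_Ioi).mono fun w hw => ?_
  have hw' : 0 < 1 + w := by have := Set.mem_Ioi.1 hw; linarith
  have hw0 : ((1 + w : ℝ) : ℂ) ≠ 0 := by exact_mod_cast hw'.ne'
  simp only [norm_mul (_ * _ : ℂ) (_ * _)]
  rw [integral_const_mul, integral_norm_cpow_mul_exp_neg_mul_Ioi hd hw', ← mul_assoc, ← norm_mul,
    mul_assoc ((w : ℂ) ^ (q - 1)), ← cpow_add _ _ hw0]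
  ring_nf

open Complex in
lemma integral_double_kernel {s d q : ℂ} (hd : 0 < d.re) (hq : 0 < q.re)
    (hp : 0 < (s + d - q).re) :
    (∫ z : ℝ × ℝ, (z.2 : ℂ) ^ (q - 1) * ((1 + z.2 : ℝ) : ℂ) ^ (-s) *
        ((z.1 : ℂ) ^ (d - 1) * ((Real.exp (-((1 + z.2) * z.1)) : ℝ) : ℂ))
      ∂((volume.restrict (Set.Ioi (0 : ℝ))).prod (volume.restrict (Set.Ioi (0 : ℝ))))) *
      Gamma (s + d) = Gamma d * Gamma q * Gamma (s + d - q) := by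
  have h := (integrableOn_cpow_mul_one_add_cpow hp hq).2
  rw [sub_add_cancel] at h
  rw [integral_prod_symm _ (integrable_double_kernel hd hq hp)]
  refine Eq.trans ?_ ((congrArg (Gamma d * ·) h).trans (by ring))
  simp only
  rw [← mul_assoc, ← integral_const_mul]
  congr 1
  refine setIntegral_congr_fun measurableSet_Ioi fun w (hw : 0 < w) => ?_
  have hw' : 0 < 1 + w := by linarith
  have hw0 : ((1 + w : ℝ) : ℂ) ≠ 0 := by exact_mod_cast hw'.ne'
  rw [integral_const_mul, integral_cpow_mul_exp_neg_real_mul_Ioi hd hw', ← mul_assoc,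
    mul_assoc ((w : ℂ) ^ (q - 1)), ← cpow_add _ _ hw0]
  ring_nf

open Complex in
lemma four_mul_div_cpow (s : ℂ) {t w : ℝ} (ht : 0 < t) (hw : 0 < w) :
    (((1 + w) / (4 * t * w) : ℝ) : ℂ) ^ (-s) =
      4 ^ s * (t : ℂ) ^ s * (w : ℂ) ^ s * ((1 + w : ℝ) : ℂ) ^ (-s) := by
  have h4 : (4 : ℂ) = ((4 : ℝ) : ℂ) := by norm_num
  rw [div_eq_mul_inv, ofReal_mul, mul_cpow_ofReal_nonneg (by linarith) (by positivity), h4,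
    ← mul_cpow_ofReal_nonneg (by norm_num) ht.le, ← ofReal_mul,
    ← mul_cpow_ofReal_nonneg (by positivity) hw.le, ← ofReal_mul, mul_comm, ofReal_inv,
    inv_cpow _ _ (by rw [arg_ofReal_of_nonneg (by positivity)]; exact Real.pi_pos.ne),
    cpow_neg, inv_inv]

/-- The integrand of the triple integral obtained from two Macdonald functions. -/
noncomputable def tripleKernel (s d q : ℂ) (z : ℝ × ℝ × ℝ) : ℂ :=
  (z.2.1 : ℂ) ^ (d - s - 1) * (z.2.2 : ℂ) ^ (q - s - 1) *
      ((Real.exp (-((1 + z.2.2) * z.2.1)) : ℝ) : ℂ) *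
    ((z.1 : ℂ) ^ (2 * s - 1) *
      ((Real.exp (-((1 + z.2.2) / (4 * z.2.1 * z.2.2) * z.1 ^ 2)) : ℝ) : ℂ))

open Complex in
lemma tripleKernel_aux (s d q : ℂ) {t w : ℝ} (ht : 0 < t) (hw : 0 < w) :
    (t : ℂ) ^ (d - s - 1) * (w : ℂ) ^ (q - s - 1) *
      ((Real.exp (-((1 + w) * t)) : ℝ) : ℂ) * (((1 + w) / (4 * t * w) : ℝ) : ℂ) ^ (-s) =
    4 ^ s * ((w : ℂ) ^ (q - 1) * ((1 + w : ℝ) : ℂ) ^ (-s) *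
        ((t : ℂ) ^ (d - 1) * ((Real.exp (-((1 + w) * t)) : ℝ) : ℂ))) := by
  have ht0 : (t : ℂ) ≠ 0 := by exact_mod_cast ht.ne'
  have hw0 : (w : ℂ) ≠ 0 := by exact_mod_cast hw.ne'
  rw [four_mul_div_cpow s ht hw, show d - 1 = (d - s - 1) + s by ring,
    show q - 1 = (q - s - 1) + s by ring, cpow_add _ _ ht0, cpow_add _ _ hw0]
  ring

lemma ae_pos_prod : ∀ᵐ z : ℝ × ℝ ∂((volume.restrict (Set.Ioi (0 : ℝ))).prod
    (volume.restrict (Set.Ioi (0 : ℝ)))), 0 < z.1 ∧ 0 < z.2 := by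
  rw [Measure.prod_restrict]
  exact (ae_restrict_mem (measurableSet_Ioi.prod measurableSet_Ioi)).mono fun z hz => hz

-- Taking norms replaces exponents by their real parts, so the x-integral of the norm is a constant
-- times the norm of the double kernel.
open Complex in
lemma integrable_tripleKernel {s d q : ℂ} (hs : 0 < s.re) (hd : 0 < d.re) (hq : 0 < q.re)
    (hp : 0 < (s + d - q).re) :
    Integrable (tripleKernel s d q)
      ((volume.restrict (Set.Ioi (0 : ℝ))).prod
        ((volume.restrict (Set.Ioi (0 : ℝ))).prod (volume.restrict (Set.Ioi (0 : ℝ))))) := by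
  have h2s : 0 < (2 * s).re := by simpa using hs
  unfold tripleKernel
  rw [integrable_prod_iff' (Measurable.aestronglyMeasurable (by fun_prop))]
  refine ⟨ae_pos_prod.mono fun z hz => (integrableOn_cpow_mul_exp_neg_mul_sq_Ioi h2s
    (r := (1 + z.2) / (4 * z.1 * z.2)) (by
    have := hz.1; have := hz.2; positivity)).const_mul
      ((z.1 : ℂ) ^ (d - s - 1) * (z.2 : ℂ) ^ (q - s - 1) *
        ((Real.exp (-((1 + z.2) * z.1)) : ℝ) : ℂ)), ?_⟩
  refine ((integrable_double_kernel hd hq hp).norm.const_mul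
    (‖(4 : ℂ) ^ s‖ * (Real.Gamma s.re / 2))).congr ?_
  refine ae_pos_prod.mono fun z hz => ?_
  obtain ⟨ht, hw⟩ := hz
  simp only [norm_mul (_ * _ : ℂ) (_ * ((Real.exp (-(_ * _ ^ 2)) : ℝ) : ℂ))]
  rw [integral_const_mul, integral_norm_cpow_mul_exp_neg_mul_sq_Ioi h2s (by positivity),
    mul_div_cancel_left₀ s two_ne_zero]
  have h := congrArg norm (tripleKernel_aux s d q ht hw)
  rw [norm_mul, norm_mul (4 ^ s : ℂ)] at h
  linear_combination -(Real.Gamma s.re / 2) * h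

open Complex in
lemma integral_tripleKernel {s d q : ℂ} (hs : 0 < s.re) (hd : 0 < d.re) (hq : 0 < q.re)
    (hp : 0 < (s + d - q).re) :
    (∫ z, tripleKernel s d q z ∂((volume.restrict (Set.Ioi (0 : ℝ))).prod
        ((volume.restrict (Set.Ioi (0 : ℝ))).prod (volume.restrict (Set.Ioi (0 : ℝ)))))) *
      Gamma (s + d) = 4 ^ s / 2 * (Gamma s * Gamma d * Gamma q * Gamma (s + d - q)) := by
  have h2s : 0 < (2 * s).re := by simpa using hs
  have h := integral_double_kernel hd hq hp
  rw [show 4 ^ s / 2 * (Gamma s * Gamma d * Gamma q * Gamma (s + d - q)) =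
    4 ^ s * (Gamma s / 2) * (Gamma d * Gamma q * Gamma (s + d - q)) by ring, ← h, ← mul_assoc,
    integral_prod_symm _ (integrable_tripleKernel hs hd hq hp), ← integral_const_mul]
  congr 1
  refine integral_congr_ae (ae_pos_prod.mono fun z hz => ?_)
  obtain ⟨ht, hw⟩ := hz
  simp only [tripleKernel]
  rw [integral_const_mul, integral_cpow_mul_exp_neg_mul_sq_Ioi h2s (by positivity),
    mul_div_cancel_left₀ s two_ne_zero, ← mul_assoc, tripleKernel_aux s d q ht hw]
  ring

/-! ### The product of two Macdonald functions. -/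

open Complex in
lemma integral_macdonald_scale (lam : ℂ) (x : ℝ) {t : ℝ} (ht : 0 < t) :
    ∫ w in Set.Ioi (0 : ℝ), (w : ℂ) ^ (-lam - 1) *
        ((Real.exp (-(t * w) - x ^ 2 / (4 * (t * w))) : ℝ) : ℂ) =
      (t : ℂ) ^ lam * ∫ u in Set.Ioi (0 : ℝ),
        ((Real.exp (-u - x ^ 2 / (4 * u)) : ℝ) : ℂ) / (u : ℂ) ^ (lam + 1) := by
  have ht0 : (t : ℂ) ≠ 0 := by exact_mod_cast ht.ne'
  have h := integral_comp_mul_left_Ioi (fun u : ℝ =>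
    ((Real.exp (-u - x ^ 2 / (4 * u)) : ℝ) : ℂ) / (u : ℂ) ^ (lam + 1)) 0 ht
  rw [mul_zero] at h
  have h' : (∫ u in Set.Ioi (0 : ℝ),
      ((Real.exp (-u - x ^ 2 / (4 * u)) : ℝ) : ℂ) / (u : ℂ) ^ (lam + 1)) =
      (t : ℂ) * ∫ w in Set.Ioi (0 : ℝ), ((Real.exp (-(t * w) - x ^ 2 / (4 * (t * w))) : ℝ) : ℂ) /
        ((t * w : ℝ) : ℂ) ^ (lam + 1) := by
    rw [h, real_smul, ← mul_assoc, ofReal_inv, mul_inv_cancel₀ ht0, one_mul]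
  rw [h', ← mul_assoc, ← integral_const_mul]
  refine setIntegral_congr_fun measurableSet_Ioi fun w hw => ?_
  have hw : 0 < w := hw
  have hw0 : (w : ℂ) ≠ 0 := by exact_mod_cast hw.ne'
  rw [ofReal_mul, mul_cpow_ofReal_nonneg ht.le hw.le, show -lam - 1 = -(lam + 1) by ring,
    cpow_neg, cpow_add _ 1 ht0, cpow_one]
  have h1 : (t : ℂ) ^ lam ≠ 0 := by simp [cpow_eq_zero_iff, ht0]
  have h2 : (w : ℂ) ^ (lam + 1) ≠ 0 := by simp [cpow_eq_zero_iff, hw0]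
  field_simp

open Complex in
lemma cpow_mul_besselK_mul_besselK (ν lam ρ : ℂ) {x : ℝ} (hx : 0 < x) :
    (x : ℂ) ^ (ρ - 1) * besselK ν x * besselK lam x =
      (2 : ℂ) ^ (-(ν + lam + 2)) * ∫ t in Set.Ioi (0 : ℝ), ∫ w in Set.Ioi (0 : ℝ),
        tripleKernel ((ρ + ν + lam) / 2) ((ρ - ν - lam) / 2) ((ρ + ν - lam) / 2) (x, t, w) := by
  have hx0 : (x : ℂ) ≠ 0 := by exact_mod_cast hx.ne'
  set I : ℂ → ℂ := fun μ => ∫ u in Set.Ioi (0 : ℝ),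
        ((Real.exp (-u - x ^ 2 / (4 * u)) : ℝ) : ℂ) / (u : ℂ) ^ (μ + 1) with hI
  have hin : ∀ t ∈ Set.Ioi (0 : ℝ), (∫ w in Set.Ioi (0 : ℝ),
        tripleKernel ((ρ + ν + lam) / 2) ((ρ - ν - lam) / 2) ((ρ + ν - lam) / 2) (x, t, w)) =
      ((Real.exp (-t - x ^ 2 / (4 * t)) : ℝ) : ℂ) / (t : ℂ) ^ (ν + 1) *
        ((x : ℂ) ^ (ρ + ν + lam - 1) * I lam) := by
    intro t ht
    have ht : 0 < t := ht
    have ht0 : (t : ℂ) ≠ 0 := by exact_mod_cast ht.ne'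
    have h1 : (t : ℂ) ^ lam ≠ 0 := by simp [cpow_eq_zero_iff, ht0]
    have hI' : I lam = (t : ℂ) ^ (-lam) * ∫ w in Set.Ioi (0 : ℝ), (w : ℂ) ^ (-lam - 1) *
        ((Real.exp (-(t * w) - x ^ 2 / (4 * (t * w))) : ℝ) : ℂ) := by
      rw [integral_macdonald_scale lam x ht, cpow_neg, ← mul_assoc, inv_mul_cancel₀ h1, one_mul]
    rw [hI', ← mul_assoc, ← mul_assoc, ← integral_const_mul]
    refine setIntegral_congr_fun measurableSet_Ioi fun w hw => ?_
    have hw : 0 < w := hw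
    simp only [tripleKernel]
    have e : Real.exp (-((1 + w) * t)) * Real.exp (-((1 + w) / (4 * t * w) * x ^ 2)) =
        Real.exp (-t - x ^ 2 / (4 * t)) * Real.exp (-(t * w) - x ^ 2 / (4 * (t * w))) := by
      rw [← Real.exp_add, ← Real.exp_add]
      congr 1
      field_simp
      ring
    have e' := congrArg (fun y : ℝ => (y : ℂ)) e
    simp only [ofReal_mul] at e'
    rw [show (ρ - ν - lam) / 2 - (ρ + ν + lam) / 2 - 1 = -(ν + 1) + -lam by ring,
      cpow_add _ _ ht0, cpow_neg _ (ν + 1), div_eq_mul_inv _ ((t : ℂ) ^ (ν + 1)),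
      show (ρ + ν - lam) / 2 - (ρ + ν + lam) / 2 - 1 = -lam - 1 by ring,
      show 2 * ((ρ + ν + lam) / 2) - 1 = ρ + ν + lam - 1 by ring]
    linear_combination ((t : ℂ) ^ (ν + 1))⁻¹ * (t : ℂ) ^ (-lam) * (w : ℂ) ^ (-lam - 1) *
      (x : ℂ) ^ (ρ + ν + lam - 1) * e'
  rw [setIntegral_congr_fun measurableSet_Ioi hin, integral_mul_const]
  simp only [besselK]
  change (x : ℂ) ^ (ρ - 1) * ((x : ℂ) ^ ν / 2 ^ (ν + 1) * I ν) *
    ((x : ℂ) ^ lam / 2 ^ (lam + 1) * I lam) = (2 : ℂ) ^ (-(ν + lam + 2)) *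
      (I ν * ((x : ℂ) ^ (ρ + ν + lam - 1) * I lam))
  rw [show -(ν + lam + 2) = -(ν + 1) + -(lam + 1) by ring,
    cpow_add (-(ν + 1)) _ two_ne_zero, cpow_neg, cpow_neg, show ρ + ν + lam - 1 = (ρ - 1) + ν + lam by ring, cpow_add _ _ hx0,
    cpow_add _ _ hx0]
  ring

open Complex in
lemma integral_cpow_mul_besselK_mul_besselK {ν lam ρ : ℂ} (h : |ν.re| + |lam.re| < ρ.re) :
    IntegrableOn (fun x : ℝ => (x : ℂ) ^ (ρ - 1) * besselK ν x * besselK lam x)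
        (Set.Ioi (0 : ℝ)) ∧
      ∫ x in Set.Ioi (0 : ℝ), (x : ℂ) ^ (ρ - 1) * besselK ν x * besselK lam x =
        2 ^ (ρ - 3) * (Gamma ((ρ + ν + lam) / 2) * Gamma ((ρ - ν - lam) / 2) *
          Gamma ((ρ + ν - lam) / 2) * Gamma ((ρ - ν + lam) / 2)) / Gamma ρ := by
  obtain ⟨hν1, hν2⟩ := abs_le.1 (le_refl |ν.re|)
  obtain ⟨hl1, hl2⟩ := abs_le.1 (le_refl |lam.re|)
  have hΓ : Gamma ρ ≠ 0 := Gamma_ne_zero_of_re_pos (by linarith)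
  have hs : 0 < ((ρ + ν + lam) / 2).re := by simp; linarith
  have hd : 0 < ((ρ - ν - lam) / 2).re := by simp; linarith
  have hq : 0 < ((ρ + ν - lam) / 2).re := by simp; linarith
  have hpe : (ρ + ν + lam) / 2 + (ρ - ν - lam) / 2 - (ρ + ν - lam) / 2 = (ρ - ν + lam) / 2 := by
    ring
  have hp : 0 < ((ρ + ν + lam) / 2 + (ρ - ν - lam) / 2 - (ρ + ν - lam) / 2).re := by
    rw [hpe]; simp; linarith
  have hint := integrable_tripleKernel hs hd hq hp
  have hval := integral_tripleKernel hs hd hq hp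
  rw [hpe, show (ρ + ν + lam) / 2 + (ρ - ν - lam) / 2 = ρ by ring] at hval
  have hae : ∀ᵐ x : ℝ ∂(volume.restrict (Set.Ioi (0 : ℝ))),
      (2 : ℂ) ^ (-(ν + lam + 2)) * (∫ z, tripleKernel ((ρ + ν + lam) / 2) ((ρ - ν - lam) / 2)
        ((ρ + ν - lam) / 2) (x, z) ∂((volume.restrict (Set.Ioi (0 : ℝ))).prod
        (volume.restrict (Set.Ioi (0 : ℝ))))) =
      (x : ℂ) ^ (ρ - 1) * besselK ν x * besselK lam x := by
    -- The slice at x is known to be integrable in (t, w) only for almost every x.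
    filter_upwards [ae_restrict_mem measurableSet_Ioi, hint.prod_right_ae] with x hx hx'
    rw [cpow_mul_besselK_mul_besselK ν lam ρ hx, integral_prod _ hx']
  refine ⟨(hint.integral_prod_left.const_mul _).congr hae, ?_⟩
  -- The powers of 2 collect as 2^(-(ν+λ+2)) · 4^((ρ+ν+λ)/2) / 2 = 2^(ρ-3).
  rw [← integral_congr_ae hae, integral_const_mul, ← integral_prod _ hint, eq_div_iff hΓ,
    mul_assoc, hval, show (4 : ℂ) = 2 * 2 by norm_num, ← ofReal_ofNat,
    mul_cpow_ofReal_nonneg zero_le_two zero_le_two, ofReal_ofNat,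
    show ρ - 3 = -(ν + lam + 2) + ((ρ + ν + lam) / 2 + (ρ + ν + lam) / 2) + -1 by ring,
    cpow_add _ _ two_ne_zero, cpow_add _ _ two_ne_zero, cpow_add _ _ two_ne_zero, cpow_neg_one]
  ring

/-! ### Reflection formula and the two-term form. -/

open Complex in
lemma one_div_Gamma_one_sub {z : ℂ} (hz : 0 < z.re) :
    (Gamma (1 - z))⁻¹ = Gamma z * sin (Real.pi * z) / Real.pi := by
  have hΓ : Gamma z ≠ 0 := Gamma_ne_zero_of_re_pos hz
  have hπ : (Real.pi : ℂ) ≠ 0 := ofReal_ne_zero.2 Real.pi_ne_zero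
  have h := Gamma_mul_Gamma_one_sub z
  by_cases h0 : sin (Real.pi * z) = 0
  -- At a pole of Γ(1-z) both sides vanish, since `Gamma` takes the value 0 at its poles.
  · rw [h0, div_zero] at h
    rw [(mul_eq_zero.1 h).resolve_left hΓ, h0]
    simp
  · rw [eq_div_iff h0] at h
    have h1 : Gamma (1 - z) ≠ 0 := by
      rintro h1
      rw [h1] at h
      simp [hπ.symm] at h
    rw [inv_eq_one_div, div_eq_div_iff h1 hπ]
    linear_combination -h

-- By product-to-sum both products contain cos(πλ), which cancels in the difference.
open Complex in
lemma sin_mul_sin_sub_sin_mul_sin (ν lam ρ : ℂ) :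
    sin (Real.pi * ((ρ + ν + lam) / 2)) * sin (Real.pi * ((ρ + ν - lam) / 2)) -
      sin (Real.pi * ((ρ - ν - lam) / 2)) * sin (Real.pi * ((ρ - ν + lam) / 2)) =
    sin (Real.pi * ν) * sin (Real.pi * ρ) := by
  have key : ∀ a b : ℂ, sin a * sin b = (cos (a - b) - cos (a + b)) / 2 := by
    intro a b; rw [cos_sub, cos_add]; ring
  rw [key, key, key, ← cos_neg (Real.pi * ((ρ - ν - lam) / 2) - Real.pi * ((ρ - ν + lam) / 2)),
    ← cos_neg (Real.pi * ν - Real.pi * ρ)]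
  ring_nf

open Complex in
lemma gamma_reflection_sum {ν lam ρ : ℂ} (h : |ν.re| + |lam.re| < ρ.re)
    (hν : ∀ n : ℤ, ν ≠ (n : ℂ)) (hρ : ∀ n : ℕ, ρ ≠ (n : ℂ) + 1) :
    Gamma ν * Gamma ((ρ + lam - ν) / 2) * Gamma ((ρ - lam - ν) / 2) * Gamma (1 - ν) *
          Gamma (1 - ρ) / (Gamma (1 - (ρ + ν + lam) / 2) * Gamma (1 - (ρ + ν - lam) / 2)) +
        Gamma (-ν) * Gamma ((ρ + lam + ν) / 2) * Gamma ((ν + ρ - lam) / 2) * Gamma (ν + 1) *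
          Gamma (1 - ρ) / (Gamma (1 - (ρ - ν - lam) / 2) * Gamma (1 - (ρ - ν + lam) / 2)) =
      (Gamma ((ρ + ν + lam) / 2) * Gamma ((ρ - ν - lam) / 2) *
          Gamma ((ρ + ν - lam) / 2) * Gamma ((ρ - ν + lam) / 2)) / Gamma ρ := by
  obtain ⟨hν1, hν2⟩ := abs_le.1 (le_refl |ν.re|)
  obtain ⟨hl1, hl2⟩ := abs_le.1 (le_refl |lam.re|)
  have hρ0 : 0 < ρ.re := by linarith
  have hΓ : Gamma ρ ≠ 0 := Gamma_ne_zero_of_re_pos hρ0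
  have hπ : (Real.pi : ℂ) ≠ 0 := ofReal_ne_zero.2 Real.pi_ne_zero
  have hsν := sin_pi_mul_ne_zero (x := ν) (by rintro ⟨n, hn⟩; exact hν n hn.symm)
  have hsρ : sin (Real.pi * ρ) ≠ 0 := by
    refine sin_pi_mul_ne_zero ?_
    rintro ⟨n, hn⟩
    replace hn : ρ = n := hn.symm
    have hn0 : 0 < n := by
      rw [hn, intCast_re] at hρ0
      exact_mod_cast hρ0
    -- An integer ρ would be positive, hence of the excluded form m + 1 with m = n - 1.
    refine hρ (n - 1).toNat ?_
    have : (((n - 1).toNat : ℤ) : ℂ) = n - 1 := by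
      rw [Int.toNat_of_nonneg (by lia)]; push_cast; ring
    rw [hn, ← Int.cast_natCast, this]
    ring
  have e1 := Gamma_mul_Gamma_one_sub ν
  have e2 := Gamma_mul_Gamma_one_sub (-ν)
  rw [sub_neg_eq_add, mul_neg, sin_neg, add_comm 1 ν] at e2
  have e3 := Gamma_mul_Gamma_one_sub ρ
  have e3' : Gamma (1 - ρ) = Real.pi / (sin (Real.pi * ρ) * Gamma ρ) := by
    rw [eq_div_iff (mul_ne_zero hsρ hΓ)]
    rw [eq_div_iff hsρ] at e3
    linear_combination e3
  have g1 := one_div_Gamma_one_sub (z := (ρ + ν + lam) / 2) (by simp; linarith)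
  have g2 := one_div_Gamma_one_sub (z := (ρ + ν - lam) / 2) (by simp; linarith)
  have g3 := one_div_Gamma_one_sub (z := (ρ - ν - lam) / 2) (by simp; linarith)
  have g4 := one_div_Gamma_one_sub (z := (ρ - ν + lam) / 2) (by simp; linarith)
  have trig := sin_mul_sin_sub_sin_mul_sin ν lam ρ
  rw [div_eq_mul_inv _ (Gamma _ * Gamma _), div_eq_mul_inv _ (Gamma _ * Gamma _), mul_inv,
    mul_inv, g1, g2, g3, g4,
    show (ρ + lam - ν) / 2 = (ρ - ν + lam) / 2 by ring,
    show (ρ - lam - ν) / 2 = (ρ - ν - lam) / 2 by ring,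
    show (ρ + lam + ν) / 2 = (ρ + ν + lam) / 2 by ring,
    show (ν + ρ - lam) / 2 = (ρ + ν - lam) / 2 by ring, e3']
  generalize Gamma ((ρ + ν + lam) / 2) = A at *
  generalize Gamma ((ρ - ν - lam) / 2) = B at *
  generalize Gamma ((ρ + ν - lam) / 2) = C at *
  generalize Gamma ((ρ - ν + lam) / 2) = D at *
  generalize sin (Real.pi * ((ρ + ν + lam) / 2)) = a at *
  generalize sin (Real.pi * ((ρ - ν - lam) / 2)) = b at *
  generalize sin (Real.pi * ((ρ + ν - lam) / 2)) = c at *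
  generalize sin (Real.pi * ((ρ - ν + lam) / 2)) = d at *
  -- Both terms share A·B·C·D; the factors Γ(ν)Γ(1-ν) and Γ(-ν)Γ(ν+1) are ±π/sin(πν), which produces
  -- the difference a·c - b·d.
  calc _ = (Gamma ν * Gamma (1 - ν)) * (A * B * C * D * (a * c)) /
          (Real.pi * (sin (Real.pi * ρ) * Gamma ρ)) +
        (Gamma (-ν) * Gamma (ν + 1)) * (A * B * C * D * (b * d)) /
          (Real.pi * (sin (Real.pi * ρ) * Gamma ρ)) := by
        field_simp
    _ = A * B * C * D * (a * c - b * d) /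
        (sin (Real.pi * ν) * (sin (Real.pi * ρ) * Gamma ρ)) := by
        rw [e1, e2]
        field_simp
        ring
    _ = _ := by
        rw [trig]
        field_simp

/-! ### Rescaling by a. -/

theorem mainTheorem5 (a : ℝ) (ν lam ρ : ℂ) (ha : 0 < a)
    (hconv : |ν.re| + |lam.re| < ρ.re)
    (hν : ∀ n : ℤ, ν ≠ (n : ℂ))
    (hρ : ∀ n : ℕ, ρ ≠ (n : ℂ) + 1) :
    IntegrableOn
        (fun x : ℝ => (x : ℂ) ^ (ρ - 1) * besselK ν (a * x) * besselK lam (a * x))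
        (Set.Ioi (0 : ℝ)) volume ∧
      ∫ x in Set.Ioi (0 : ℝ),
          (x : ℂ) ^ (ρ - 1) * besselK ν (a * x) * besselK lam (a * x) =
        (2 : ℂ) ^ (ρ - 3) * Complex.Gamma ν * Complex.Gamma ((ρ + lam - ν) / 2) *
              Complex.Gamma ((ρ - lam - ν) / 2) * Complex.Gamma (1 - ν) *
              Complex.Gamma (1 - ρ) /
            ((a : ℂ) ^ ρ * Complex.Gamma (1 - (ρ + ν + lam) / 2) *
              Complex.Gamma (1 - (ρ + ν - lam) / 2)) +
          (2 : ℂ) ^ (ρ - 3) * Complex.Gamma (-ν) * Complex.Gamma ((ρ + lam + ν) / 2) *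
              Complex.Gamma ((ν + ρ - lam) / 2) * Complex.Gamma (ν + 1) *
              Complex.Gamma (1 - ρ) /
            ((a : ℂ) ^ ρ * Complex.Gamma (1 - (ρ - ν - lam) / 2) *
              Complex.Gamma (1 - (ρ - ν + lam) / 2)) := by
  have ha0 : (a : ℂ) ≠ 0 := by exact_mod_cast ha.ne'
  obtain ⟨hint, hval⟩ := integral_cpow_mul_besselK_mul_besselK hconv
  have hscale : ∀ x ∈ Set.Ioi (0 : ℝ), (a : ℂ) ^ (-(ρ - 1)) * (((a * x : ℝ) : ℂ) ^ (ρ - 1) *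
      besselK ν (a * x) * besselK lam (a * x)) =
      (x : ℂ) ^ (ρ - 1) * besselK ν (a * x) * besselK lam (a * x) := by
    intro x hx
    rw [Complex.ofReal_mul, Complex.mul_cpow_ofReal_nonneg ha.le (le_of_lt hx), Complex.cpow_neg]
    have : (a : ℂ) ^ (ρ - 1) ≠ 0 := by simp [Complex.cpow_eq_zero_iff, ha0]
    field_simp
  constructor
  · refine IntegrableOn.congr_fun (Integrable.const_mul ?_ _) hscale measurableSet_Ioi
    exact (integrableOn_Ioi_comp_mul_left_iff
      (fun x : ℝ => (x : ℂ) ^ (ρ - 1) * besselK ν x * besselK lam x) 0 ha).2 (by simpa using hint)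
  · rw [← setIntegral_congr_fun measurableSet_Ioi hscale, integral_const_mul,
      integral_comp_mul_left_Ioi
        (fun x : ℝ => (x : ℂ) ^ (ρ - 1) * besselK ν x * besselK lam x) 0 ha, mul_zero, hval,
      mul_div_assoc, ← gamma_reflection_sum hconv hν hρ, Complex.real_smul, ← mul_assoc,
      Complex.ofReal_inv, ← Complex.cpow_neg_one, ← Complex.cpow_add _ _ ha0,
      show -(ρ - 1) + -1 = -ρ by ring, Complex.cpow_neg]
    ring
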